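/- Let $d\ge 0$ and $k\ge 4$ be integers and let $a_1,\dots,a_k$ be positive integers. The $k$-chain $C_{a_1,\dots,a_k}$ is the graph whose vertex set is the disjoint union of sets $A_1,\dots,A_k$ with $|A_i|=a_i$, in which every vertex of $A_i$ is adjacent to every vertex of $A_{i+1}$ for $1\le i\le k-1$, and which has no other edges. A graph is $(d+1)$-connected if it has more than $d+1$ vertices and stays connected whenever at most $d$ vertices are removed. A realization of a graph $G=(V,E)$ in $\mathbb{R}^d$ is a map $p:V\to\mathbb{R}^d$; it is generic if its $|V|d$ coordinates are algebraically independent over $\mathbb{Q}$. A flexing of the framework $G(p)$ is a differentiable family $(q_t)_{t\in[0,1]}$ of realizations with $q_0=p$ and $|q_t(u)-q_t(v)|=|p(u)-p(v)|$ for all $\{u,v\}\in E$ and all $t\in[0,1]$; it is trivial if each $q_t$ is the image of $p$ under some isometry of $\mathbb{R}^d$. The framework $G(p)$ is locally rigid if all its flexings are trivial, and redundantly rigid if for every $e\in E$ the framework $(G\setminus\{e\})(p)$ is locally rigid. The graph $G$ is generically redundantly rigid in $\mathbb{R}^d$ if $G(p)$ is redundantly rigid for every generic realization $p$ in $\mathbb{R}^d$.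 Suppose that $C_{a_1,\dots,a_k}$ is $(d+1)$-connected and that $a_1+\dots+a_k=\binom{d+2}{2}$. Then $C_{a_1,\dots,a_k}$ is generically redundantly rigid in $\mathbb{R}^d$ if and only if both of the following hold: 1. $a_2\ge d+2$ and $a_{k-1}\ge d+2$; 2. there is no $i$ with $1\le i\le k-1$ and $a_i=a_{i+1}=d+1$. Moreover, some generic realization of $C_{a_1,\dots,a_k}$ in $\mathbb{R}^d$ is redundantly rigid if and only if both 1 and 2 hold. -/

import Mathlib

/-- Realizations in `ℝ^d` of a vertex set `V`: assignments of a point of Euclidean `d`-space to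
each vertex. A framework `G(p)` is a graph `G` on `V` together with a realization `p`. -/
abbrev Realization (V : Type) (d : ℕ) : Type := V → EuclideanSpace ℝ (Fin d)

/-- A realization is generic if its `|V| * d` coordinates are algebraically independent
over the rationals. -/
def IsGenericRealization {V : Type} {d : ℕ} (p : Realization V d) : Prop :=
  AlgebraicIndependent ℚ (fun x : V × Fin d => p x.1 x.2)

/-- A flexing of `G(p)`: a differentiable one-parameter family `q t`, `t ∈ [0, 1]`, of realizations
which starts at `p` and along which all edges of `G` keep their lengths. -/
structure IsFlexing {V : Type} [Fintype V] {d : ℕ} (G : SimpleGraph V) (p : Realization V d)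
    (q : ℝ → Realization V d) : Prop where
  differentiableOn : DifferentiableOn ℝ q (Set.Icc 0 1)
  start : q 0 = p
  edge_dist : ∀ t ∈ Set.Icc (0 : ℝ) 1, ∀ u v : V, G.Adj u v →
    dist (q t u) (q t v) = dist (p u) (p v)

/-- A flexing is trivial if each of its members is the image of `p` under a Euclidean motion,
that is, a distance preserving bijection of `ℝ^d`. -/
def IsTrivialFlexing {V : Type} {d : ℕ} (p : Realization V d) (q : ℝ → Realization V d) : Prop :=
  ∀ t ∈ Set.Icc (0 : ℝ) 1,
    ∃ g : EuclideanSpace ℝ (Fin d) ≃ᵢ EuclideanSpace ℝ (Fin d), ∀ v : V, q t v = g (p v)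

/-- The framework `G(p)` is locally rigid if all its flexings are trivial. -/
def IsLocallyRigid {V : Type} [Fintype V] {d : ℕ} (G : SimpleGraph V) (p : Realization V d) :
    Prop :=
  ∀ q : ℝ → Realization V d, IsFlexing G p q → IsTrivialFlexing p q

/-- The framework `G(p)` is redundantly rigid if every edge is redundant: removing that single edge
leaves a locally rigid framework. -/
def IsRedundantlyRigid {V : Type} [Fintype V] {d : ℕ} (G : SimpleGraph V) (p : Realization V d) :
    Prop :=
  ∀ e ∈ G.edgeSet, IsLocallyRigid (G.deleteEdges {e}) p

/-- Generic redundant rigidity in `ℝ^d`: all generic frameworks of `G` are redundantly rigid. -/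
def IsGenericallyRedundantlyRigid {V : Type} [Fintype V] (d : ℕ) (G : SimpleGraph V) : Prop :=
  ∀ p : Realization V d, IsGenericRealization p → IsRedundantlyRigid G p

/-- Vertex `n`-connectedness: there are more than `n` vertices, and the graph stays connected
whenever fewer than `n` vertices are removed. -/
def IsVertexConnected {V : Type} [Fintype V] (n : ℕ) (G : SimpleGraph V) : Prop :=
  n < Fintype.card V ∧
    ∀ S : Finset V, S.card < n → (G.induce {v : V | v ∉ S}).Connected

/-- Vertices of the `k`-chain: the disjoint union of sets `A_i` of size `a i`. The indices here run
over `0, …, k - 1`, so that `a i` is the size of the part number `i + 1`. -/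
abbrev ChainVertex {k : ℕ} (a : Fin k → ℕ) : Type := Σ i : Fin k, Fin (a i)

/-- The `k`-chain: all edges between consecutive parts, and no others. -/
def chainGraph {k : ℕ} (a : Fin k → ℕ) : SimpleGraph (ChainVertex a) where
  Adj x y := (x.1 : ℕ) + 1 = (y.1 : ℕ) ∨ (y.1 : ℕ) + 1 = (x.1 : ℕ)
  symm := ⟨fun _ _ h => h.symm⟩
  loopless := ⟨fun _ h => by omega⟩

/-!
Write `P u = (1, p u)` for the homogeneous coordinates of the points, and encode the velocity `w u`
as `U u = (-⟪p u, w u⟫, w u)`, a vector orthogonal to `P u`. The first-order condition on an edge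
`uv` becomes `P u ⬝ U v + P v ⬝ U u = 0`. On a complete bipartite graph both of whose sides span in
homogeneous coordinates, the solutions of these equations are `U u = T (P u)` on one side and
`U v = -Tᵀ (P v)` on the other, for an arbitrary matrix `T`, and a further vertex with `d + 1`
neighbours in general position is forced to follow the same `T`
(`exists_subset_linearVelocitySet`, `mem_linearVelocitySet`). The remaining equations
`P u ⬝ U u = 0` say that the quadric of the symmetric part of `T` passes through all points. As there
are `(d + 2).choose 2` generic points, no quadric does, so `T` is skew-symmetric and the motion is
trivial.

Connectivity makes the inner parts of the chain have at least `d + 1` vertices each. If the two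
conditions hold, a single missing edge does not stop the propagation of `T` through the chain, and
every realization in general position is infinitesimally rigid without that edge. General position
is an open condition, so differentiating the distances along a flexing shows that they stay
constant (`isLocallyRigid_of_eventually`).

If a condition fails, the chain without a suitable edge `xy` has further solutions of the edge
equations: a vertex `x` with only `d + 1` neighbours can be given the velocity orthogonal to all of
them but `y`, and the matrices `T` on the two sides of a pair of consecutive parts of size `d + 1`
can differ by a matrix of rank one. Such a solution has to be corrected by a symmetric matrix in
order to satisfy `P u ⬝ U u = 0`, which is possible exactly because quadrics can be interpolated at
the `(d + 2).choose 2` points. By Cramer's rule, without the denominators, the result is a polynomial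
vector field on the space of all realizations. It preserves the lengths of all edges other than
`xy`, so its integral curve through `p` is a flexing, and it changes the distance of `x` and `y`
(`not_isLocallyRigid_of_edge_equations`, `not_isLocallyRigid_of_contDiff`).
-/

open Matrix

/-! ### Existence of generic realizations -/

/-- The reals contain algebraically independent families of every finite size. -/
theorem exists_isGenericRealization (V : Type) [Finite V] (d : ℕ) :
    ∃ p : Realization V d, IsGenericRealization p := by
  obtain ⟨s, hs⟩ := exists_isTranscendenceBasis ℚ ℝ
  have hinf : Infinite s := by
    by_contra hfin
    rw [not_infinite_iff_finite] at hfin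
    have := hs.isAlgebraic
    have h1 := Algebra.IsAlgebraic.cardinalMk_le_max (Algebra.adjoin ℚ (Set.range ((↑) : s → ℝ))) ℝ
    have h2 : Cardinal.mk (Algebra.adjoin ℚ (Set.range ((↑) : s → ℝ))) ≤ Cardinal.aleph0 := by
      rw [← Cardinal.mk_congr hs.1.aevalEquiv.toEquiv]
      refine MvPolynomial.cardinalMk_le_max.trans ?_
      simp
    have h3 : Cardinal.mk ℝ ≤ Cardinal.aleph0 := h1.trans (max_le h2 le_rfl)
    rw [Cardinal.mk_real] at h3
    exact absurd h3 (not_le.2 Cardinal.aleph0_lt_continuum)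
  have : Fintype V := Fintype.ofFinite V
  let f : V × Fin d ↪ s :=
    (Fintype.equivFin (V × Fin d)).toEmbedding.trans
      (Fin.valEmbedding.trans (Infinite.natEmbedding s))
  refine ⟨fun v => WithLp.toLp 2 fun j => (f (v, j) : ℝ), ?_⟩
  exact hs.1.comp f f.injective

/-! ### Congruence and flexings -/

/-- Two finite point families with the same pairwise distances differ by a Euclidean motion. -/
theorem exists_isometryEquiv_of_dist_eq {V : Type} [Fintype V] {d : ℕ} {p q : Realization V d}
    (h : ∀ u v, dist (q u) (q v) = dist (p u) (p v)) :
    ∃ g : EuclideanSpace ℝ (Fin d) ≃ᵢ EuclideanSpace ℝ (Fin d), ∀ v, q v = g (p v) := by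
  classical
  rcases isEmpty_or_nonempty V with hV | ⟨⟨o⟩⟩
  · exact ⟨IsometryEquiv.refl _, fun v => (hV.false v).elim⟩
  have hin : ∀ u v, inner ℝ (q u - q o) (q v - q o) = inner ℝ (p u - p o) (p v - p o) := by
    intro u v
    rw [real_inner_eq_norm_mul_self_add_norm_mul_self_sub_norm_sub_mul_self_div_two,
      real_inner_eq_norm_mul_self_add_norm_mul_self_sub_norm_sub_mul_self_div_two,
      sub_sub_sub_cancel_right, sub_sub_sub_cancel_right]
    simp only [← dist_eq_norm, h]
  let Φ : Realization V d → (V → ℝ) →ₗ[ℝ] EuclideanSpace ℝ (Fin d) := fun r =>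
    Fintype.linearCombination ℝ fun v => r v - r o
  have hΦ : ∀ r c, Φ r c = ∑ v, c v • (r v - r o) := fun r c => by
    simp [Φ, Fintype.linearCombination_apply]
  have hnorm : ∀ c, ‖Φ q c‖ = ‖Φ p c‖ := by
    intro c
    rw [← sq_eq_sq₀ (norm_nonneg _) (norm_nonneg _), ← real_inner_self_eq_norm_sq,
      ← real_inner_self_eq_norm_sq, hΦ, hΦ]
    simp only [sum_inner, inner_sum, inner_smul_left, inner_smul_right, hin]
  have hker : LinearMap.ker (Φ p) ≤ LinearMap.ker (Φ q) := by
    intro c hc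
    rw [LinearMap.mem_ker] at hc ⊢
    rw [← norm_eq_zero, hnorm, hc, norm_zero]
  let L₀ : LinearMap.range (Φ p) →ₗ[ℝ] EuclideanSpace ℝ (Fin d) :=
    ((LinearMap.ker (Φ p)).liftQ (Φ q) hker).comp (Φ p).quotKerEquivRange.symm.toLinearMap
  have hL₀ : ∀ c, L₀ ⟨Φ p c, c, rfl⟩ = Φ q c := by
    intro c
    have : (⟨Φ p c, c, rfl⟩ : LinearMap.range (Φ p)) =
        (Φ p).quotKerEquivRange ((LinearMap.ker (Φ p)).mkQ c) := by
      ext1; simp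
    simp [L₀, this]
  let L : LinearMap.range (Φ p) →ₗᵢ[ℝ] EuclideanSpace ℝ (Fin d) :=
    ⟨L₀, by
      rintro ⟨_, c, rfl⟩
      rw [hL₀, hnorm]; rfl⟩
  have hL : ∀ v, L.extend (p v - p o) = q v - q o := by
    intro v
    have h1 : ∀ r, Φ r (Pi.single v 1) = r v - r o := fun r => by
      rw [hΦ, Finset.sum_eq_single v] <;> simp +contextual
    have h2 := L.extend_apply ⟨Φ p (Pi.single v 1), _, rfl⟩
    have h3 : L ⟨Φ p (Pi.single v 1), _, rfl⟩ = Φ q (Pi.single v 1) := hL₀ _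
    rw [h3] at h2
    simpa only [h1] using h2
  let E := L.extend.toLinearIsometryEquiv rfl
  refine ⟨((IsometryEquiv.subRight (p o)).trans E.toIsometryEquiv).trans
    (IsometryEquiv.addRight (q o)), fun v => ?_⟩
  have : E (p v - p o) = q v - q o := hL v
  change q v = E (p v - p o) + q o
  rw [this, sub_add_cancel]

/-- The derivative of a squared edge length along a moving framework. -/
theorem hasDerivWithinAt_norm_sq_sub {V : Type} [Fintype V] {d : ℕ} {q : ℝ → Realization V d}
    {w : Realization V d} {s : Set ℝ} {t : ℝ} (h : HasDerivWithinAt q w s t) (u v : V) :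
    HasDerivWithinAt (fun t => ‖q t u - q t v‖ ^ 2)
      (2 * inner ℝ (q t u - q t v) (w u - w v)) s t := by
  have hu := hasDerivWithinAt_pi.1 h u
  have hv := hasDerivWithinAt_pi.1 h v
  exact (hu.sub hv).norm_sq

/-- A first-order velocity field that is defined on all realizations, infinitesimally preserves
the edges of `H`, and infinitesimally changes the distance of `x` and `y` at `p`, integrates to a
nontrivial flexing of `H(p)`. -/
theorem not_isLocallyRigid_of_contDiff {V : Type} [Fintype V] {d : ℕ} (H : SimpleGraph V)
    (p : Realization V d) (w : Realization V d → Realization V d) (hw : ContDiff ℝ 1 w)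
    (hH : ∀ q u v, H.Adj u v → inner ℝ (q u - q v) (w q u - w q v) = 0)
    (x y : V) (hxy : inner ℝ (p x - p y) (w p x - w p y) ≠ 0) : ¬ IsLocallyRigid H p := by
  intro hrig
  obtain ⟨γ, hγ0, ε, hε, hγ⟩ := hw.contDiffAt (x := p)
    |>.exists_forall_mem_closedBall_exists_eq_forall_mem_Ioo_hasDerivAt₀ 0
  let c : ℝ := ε / 2
  have hc : 0 < c := by positivity
  have hmem : ∀ t ∈ Set.Icc (0 : ℝ) 1, c * t ∈ Set.Ioo (0 - ε) (0 + ε) := by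
    intro t ht
    have h1 : c * t ≤ c * 1 := mul_le_mul_of_nonneg_left ht.2 hc.le
    have h2 : 0 ≤ c * t := mul_nonneg hc.le ht.1
    have h3 : c = ε / 2 := rfl
    constructor <;> linarith
  let q : ℝ → Realization V d := fun t => γ (c * t)
  have hq : ∀ t ∈ Set.Icc (0 : ℝ) 1, HasDerivAt q (c • w (q t)) t := by
    intro t ht
    have h1 : HasDerivAt (fun t : ℝ => c * t) c t := by simpa using (hasDerivAt_id t).const_mul c
    exact (hγ _ (hmem t ht)).scomp t h1
  have hq0 : q 0 = p := by simp [q, hγ0]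
  have hder : ∀ t ∈ Set.Icc (0 : ℝ) 1, ∀ u v, HasDerivWithinAt (fun t => ‖q t u - q t v‖ ^ 2)
      (2 * (c * inner ℝ (q t u - q t v) (w (q t) u - w (q t) v))) (Set.Icc 0 1) t := by
    intro t ht u v
    have := hasDerivWithinAt_norm_sq_sub (hq t ht).hasDerivWithinAt (s := Set.Icc 0 1) u v
    simpa only [Pi.smul_apply, ← smul_sub, inner_smul_right] using this
  have hflex : IsFlexing H p q := by
    refine ⟨fun t ht => (hq t ht).differentiableAt.differentiableWithinAt, hq0, ?_⟩
    intro t ht u v huv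
    have hconst := constant_of_derivWithin_zero
      (f := fun t => ‖q t u - q t v‖ ^ 2) (a := 0) (b := 1)
      (fun s hs => (hder s hs u v).differentiableWithinAt)
      (fun s hs => by
        have hs' := Set.Ico_subset_Icc_self hs
        rw [(hder s hs' u v).derivWithin (uniqueDiffOn_Icc one_pos s hs'), hH _ _ _ huv]
        simp) t ht
    simp only [hq0] at hconst
    rw [dist_eq_norm, dist_eq_norm]
    exact (sq_eq_sq₀ (norm_nonneg _) (norm_nonneg _)).1 hconst
  have htriv := hrig q hflex
  have h0 : (0 : ℝ) ∈ Set.Icc (0 : ℝ) 1 := by simp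
  have hconst : HasDerivWithinAt (fun t => ‖q t x - q t y‖ ^ 2) 0 (Set.Icc 0 1) 0 := by
    refine (hasDerivWithinAt_const (0 : ℝ) _ (‖p x - p y‖ ^ 2)).congr (fun t ht => ?_) (by rw [hq0])
    obtain ⟨g, hg⟩ := htriv t ht
    rw [← dist_eq_norm, ← dist_eq_norm, hg, hg, g.isometry.dist_eq]
  have := (uniqueDiffOn_Icc one_pos (0 : ℝ) h0).eq_deriv _ (hder 0 h0 x y) hconst
  rw [hq0] at this
  have h2 : (2 : ℝ) * (c * inner ℝ (p x - p y) (w p x - w p y)) ≠ 0 := by positivity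
  exact h2 this

/-- If all realizations near `p` are infinitesimally rigid as frameworks of `H`, then `H(p)` is
locally rigid: the distances of a flexing cannot change while it stays close to a congruent copy of
`p`, so that the set of times at which it is congruent to `p` is open as well as closed. -/
theorem isLocallyRigid_of_eventually {V : Type} [Fintype V] {d : ℕ} (H : SimpleGraph V)
    (p : Realization V d)
    (hinf : ∀ᶠ q in nhds p, ∀ w : Realization V d,
      (∀ u v, H.Adj u v → inner ℝ (q u - q v) (w u - w v) = 0) →
        ∀ u v, inner ℝ (q u - q v) (w u - w v) = 0) :
    IsLocallyRigid H p := by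
  intro q hq
  let s : Set ℝ := {t | ∀ u v, dist (q t u) (q t v) = dist (p u) (p v)}
  suffices hs : Set.Icc (0 : ℝ) 1 ⊆ s from fun t ht => exists_isometryEquiv_of_dist_eq (hs ht)
  have hcont : ContinuousOn q (Set.Icc 0 1) := hq.differentiableOn.continuousOn
  have hcv : ∀ v, ContinuousOn (fun t => q t v) (Set.Icc 0 1) := fun v =>
    continuousOn_pi.1 hcont v
  refine IsClosed.Icc_subset_of_forall_exists_gt ?_ ?_ ?_
  · have hF : ContinuousOn (fun t u v => dist (q t u) (q t v)) (Set.Icc 0 1) :=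
      continuousOn_pi.2 fun u => continuousOn_pi.2 fun v => 
        continuous_dist.comp_continuousOn ((hcv u).prodMk (hcv v))
    convert hF.preimage_isClosed_of_isClosed isClosed_Icc
      (isClosed_singleton (x := fun u v => dist (p u) (p v))) using 1
    ext t
    simp [s, funext_iff, and_comm]
  · intro u v; rw [hq.start]
  · rintro t₀ ⟨ht₀, ht01⟩ y hy
    obtain ⟨g, hg⟩ := exists_isometryEquiv_of_dist_eq ht₀
    let A := g.symm.toRealAffineIsometryEquiv
    have hA : ∀ z, A z = g.symm z := fun z => rfl
    let r : ℝ → Realization V d := fun t v => A (q t v)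
    have hr0 : r t₀ = p := by
      funext v; simp [r, hA, hg]
    have hrd : ∀ t ∈ Set.Icc (0 : ℝ) 1, DifferentiableWithinAt ℝ r (Set.Icc 0 1) t := by
      intro t ht
      refine differentiableWithinAt_pi.2 fun v => ?_
      have h1 := differentiableWithinAt_pi.1 (hq.differentiableOn t ht) v
      exact (A.toAffineIsometry.toContinuousAffineMap.differentiable _).comp_differentiableWithinAt
        t h1
    have hrdist : ∀ t u v, dist (r t u) (r t v) = dist (q t u) (q t v) := fun t u v =>
      A.isometry.dist_eq _ _
    have hcr : ContinuousWithinAt r (Set.Icc 0 1) t₀ :=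
      (hrd t₀ (Set.Ico_subset_Icc_self ht01)).continuousWithinAt
    have hev := hcr.eventually (by rw [hr0]; exact hinf)
    obtain ⟨δ, hδ, hball⟩ := Metric.mem_nhdsWithin_iff.1 hev
    let b : ℝ := min (t₀ + δ / 2) (min y 1)
    have hb0 : t₀ < b := lt_min (by linarith) (lt_min hy ht01.2)
    have hb1 : b ≤ 1 := (min_le_right _ _).trans (min_le_right _ _)
    have hbδ : b ≤ t₀ + δ / 2 := min_le_left _ _
    have hsub : Set.Icc t₀ b ⊆ Set.Icc 0 1 := Set.Icc_subset_Icc ht01.1 hb1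
    refine ⟨b, fun u v => ?_, hb0, (min_le_right _ _).trans (min_le_left _ _)⟩
    have hder : ∀ t ∈ Set.Icc t₀ b, ∀ u v, HasDerivWithinAt (fun t => ‖r t u - r t v‖ ^ 2)
        (2 * inner ℝ (r t u - r t v)
          (derivWithin r (Set.Icc t₀ b) t u - derivWithin r (Set.Icc t₀ b) t v))
        (Set.Icc t₀ b) t := fun t ht u v =>
      hasDerivWithinAt_norm_sq_sub ((hrd t (hsub ht)).mono hsub).hasDerivWithinAt u v
    have huniq := uniqueDiffOn_Icc hb0
    have hzero : ∀ t ∈ Set.Icc t₀ b, ∀ u v, inner ℝ (r t u - r t v)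
        (derivWithin r (Set.Icc t₀ b) t u - derivWithin r (Set.Icc t₀ b) t v) = 0 := by
      intro t ht
      refine hball ⟨?_, hsub ht⟩ _ fun u v huv => ?_
      · rw [Metric.mem_ball, Real.dist_eq, abs_lt]
        constructor <;> linarith [ht.1, ht.2]
      · have hconst : HasDerivWithinAt (fun t => ‖r t u - r t v‖ ^ 2) 0 (Set.Icc t₀ b) t := by
          refine (hasDerivWithinAt_const t _ (‖p u - p v‖ ^ 2)).congr_of_mem (fun t ht => ?_) ht
          rw [← dist_eq_norm, ← dist_eq_norm, hrdist, hq.edge_dist t (hsub ht) u v huv]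
        have := (huniq t ht).eq_deriv _ (hder t ht u v) hconst
        linarith
    have hconst := constant_of_derivWithin_zero
      (f := fun t => ‖r t u - r t v‖ ^ 2)
      (fun t ht => (hder t ht u v).differentiableWithinAt)
      (fun t ht => by
        have ht' := Set.Ico_subset_Icc_self ht
        rw [(hder t ht' u v).derivWithin (huniq t ht'), hzero t ht', mul_zero])
      b ⟨hb0.le, le_rfl⟩
    simp only [hr0] at hconst
    rw [← hrdist, dist_eq_norm, dist_eq_norm]
    exact (sq_eq_sq₀ (norm_nonneg _) (norm_nonneg _)).1 hconst

/-! ### General position with respect to hyperplanes and quadrics -/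

/-- Homogeneous coordinates `(1, x)` of a point `x`; the coordinate `none` is the constant one. -/
def homog {R : Type} [One R] {d : ℕ} (x : Fin d → R) : Option (Fin d) → R := fun o => o.elim 1 x

/-- The square matrix whose rows are the homogeneous coordinates of `d + 1` of the points. -/
def pointMatrix {R V : Type} [One R] {d : ℕ} (f : Option (Fin d) → V) (x : V → Fin d → R) :
    Matrix (Option (Fin d)) (Option (Fin d)) R :=
  Matrix.of fun i j => homog (x (f i)) j

/-- The matrix of the evaluation of quadrics at the points `x u`. The coefficients of a quadric are
indexed by the unordered pairs of homogeneous coordinates; `e` identifies these with the vertices,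
so that the matrix is square when there are `(d + 2).choose 2` points. -/
def veroneseMatrix {R V : Type} [CommRing R] {d : ℕ} (e : V ≃ Sym2 (Option (Fin d)))
    (x : V → Fin d → R) : Matrix V V R :=
  Matrix.of fun u v => ∑ i, ∑ j, if s(i, j) = e v then homog (x u) i * homog (x u) j else 0

/-- The symmetric matrix of the quadric with coefficients `c`. -/
def quadricMatrix {R V : Type} {d : ℕ} (e : V ≃ Sym2 (Option (Fin d))) (c : V → R) :
    Matrix (Option (Fin d)) (Option (Fin d)) R :=
  Matrix.of fun i j => c (e.symm s(i, j))

section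

variable {V : Type} {d : ℕ}

theorem quadricMatrix_transpose {R : Type} (e : V ≃ Sym2 (Option (Fin d))) (c : V → R) :
    (quadricMatrix e c)ᵀ = quadricMatrix e c := by
  ext i j
  simp [quadricMatrix, Sym2.eq_swap]

theorem pointMatrix_mulVec {R : Type} [CommRing R] (f : Option (Fin d) → V) (x : V → Fin d → R)
    (z : Option (Fin d) → R) (i : Option (Fin d)) :
    (pointMatrix f x *ᵥ z) i = homog (x (f i)) ⬝ᵥ z := rfl

theorem veroneseMatrix_mulVec {R : Type} [CommRing R] [Fintype V]
    (e : V ≃ Sym2 (Option (Fin d)))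
    (x : V → Fin d → R) (c : V → R) (u : V) :
    (veroneseMatrix e x *ᵥ c) u = homog (x u) ⬝ᵥ quadricMatrix e c *ᵥ homog (x u) := by
  classical
  simp only [mulVec, dotProduct, veroneseMatrix, quadricMatrix, of_apply, Finset.sum_mul,
    Finset.mul_sum]
  rw [Finset.sum_comm]
  refine Finset.sum_congr rfl fun i _ => ?_
  rw [Finset.sum_comm]
  refine Finset.sum_congr rfl fun j _ => ?_
  rw [Finset.sum_eq_single (e.symm s(i, j))]
  · simp; ring
  · intro v _ hv
    rw [if_neg, zero_mul]
    intro h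
    exact hv (by rw [h, Equiv.symm_apply_apply])
  · simp

/-- The points are in general position with respect to hyperplanes and to quadrics: any `d + 1` of
them are affinely independent, and no quadric passes through all of them. The second condition is
vacuous unless the number of points is `(d + 2).choose 2`, the dimension of the space of
quadrics. -/
structure IsQuadricGeneral [Fintype V] [DecidableEq V] (p : Realization V d) : Prop where
  det_pointMatrix_ne_zero : ∀ f : Option (Fin d) → V, Function.Injective f →
    (pointMatrix f fun u => p u).det ≠ 0
  det_veroneseMatrix_ne_zero : ∀ e : V ≃ Sym2 (Option (Fin d)),
    (veroneseMatrix e fun u => p u).det ≠ 0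

/-- A polynomial that does not vanish at some realization does not vanish at generic ones. -/
theorem IsGenericRealization.aeval_ne_zero {p : Realization V d} (hp : IsGenericRealization p)
    (F : MvPolynomial (V × Fin d) ℚ) (x : V → Fin d → ℝ)
    (hx : MvPolynomial.aeval (fun z : V × Fin d => x z.1 z.2) F ≠ 0) :
    MvPolynomial.aeval (fun z : V × Fin d => p z.1 z.2) F ≠ 0 := by
  intro h
  apply hx
  rw [(injective_iff_map_eq_zero _).1 hp F h, map_zero]

theorem aeval_homog_X (x : V → Fin d → ℝ) (u : V) (i : Option (Fin d)) :
    MvPolynomial.aeval (fun z : V × Fin d => x z.1 z.2)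
      (homog (fun j => MvPolynomial.X (R := ℚ) (u, j)) i) = homog (x u) i := by
  cases i <;> simp [homog]

theorem IsGenericRealization.det_pointMatrix_ne_zero {p : Realization V d}
    (hp : IsGenericRealization p) {f : Option (Fin d) → V} (hf : Function.Injective f) :
    (pointMatrix f fun u => p u).det ≠ 0 := by
  classical
  let F : MvPolynomial (V × Fin d) ℚ :=
    (pointMatrix f fun u j => MvPolynomial.X (R := ℚ) (u, j)).det
  have hF : ∀ x : V → Fin d → ℝ,
      MvPolynomial.aeval (fun z : V × Fin d => x z.1 z.2) F = (pointMatrix f x).det := by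
    intro x
    rw [← AlgHom.coe_toRingHom, RingHom.map_det]
    congr 1
    ext i j
    simp [pointMatrix, aeval_homog_X]
  rw [← hF]
  -- The origin and the standard basis vectors are affinely independent.
  let x : V → Fin d → ℝ := fun u j => if u = f (some j) then 1 else 0
  refine hp.aeval_ne_zero F x ?_
  rw [hF]
  intro h0
  obtain ⟨z, hz, hz0⟩ := exists_mulVec_eq_zero_iff.2 h0
  have hx : ∀ i j, x (f i) j = if i = some j then 1 else 0 := fun i j => by
    simp [x, hf.eq_iff]
  have hrow : ∀ i, homog (x (f i)) ⬝ᵥ z = 0 := fun i => by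
    rw [← pointMatrix_mulVec, hz0]; rfl
  have h1 : z none = 0 := by
    simpa [dotProduct, Fintype.sum_option, homog, hx] using hrow none
  apply hz
  funext i
  cases i with
  | none => exact h1
  | some j => simpa [dotProduct, Fintype.sum_option, homog, hx, h1] using hrow (some j)

/-- No quadric passes through `(d + 2).choose 2` generic points, because none passes through the
points `b i + b j`, with `b none` the origin and `b (some k)` the standard basis vectors. -/
theorem IsGenericRealization.det_veroneseMatrix_ne_zero [Fintype V] [DecidableEq V]
    {p : Realization V d} (hp : IsGenericRealization p) (e : V ≃ Sym2 (Option (Fin d))) :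
    (veroneseMatrix e fun u => p u).det ≠ 0 := by
  classical
  let F : MvPolynomial (V × Fin d) ℚ :=
    (veroneseMatrix e fun u j => MvPolynomial.X (R := ℚ) (u, j)).det
  have hF : ∀ x : V → Fin d → ℝ,
      MvPolynomial.aeval (fun z : V × Fin d => x z.1 z.2) F = (veroneseMatrix e x).det := by
    intro x
    rw [← AlgHom.coe_toRingHom, RingHom.map_det]
    congr 1
    ext i j
    simp [veroneseMatrix, aeval_homog_X, apply_ite]
  rw [← hF]
  let b : Option (Fin d) → Fin d → ℝ := fun i j => if i = some j then 1 else 0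
  -- Homogeneous coordinates in which `b i + b j` becomes the sum `H i + H j`.
  let H : Option (Fin d) → Option (Fin d) → ℝ := fun i o => o.elim (1 / 2) (b i)
  let B : Sym2 (Option (Fin d)) → Fin d → ℝ :=
    Sym2.lift ⟨fun i j => b i + b j, fun i j => add_comm _ _⟩
  have hB : ∀ i j, homog (B s(i, j)) = H i + H j := by
    intro i j
    funext o
    cases o <;> simp [homog, B, H]; norm_num
  refine hp.aeval_ne_zero F (fun u => B (e u)) ?_
  rw [hF fun u => B (e u)]
  intro h0
  obtain ⟨c, hc, hc0⟩ := exists_mulVec_eq_zero_iff.2 h0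
  set S := quadricMatrix e c with hS
  have hSsymm : ∀ z w, z ⬝ᵥ S *ᵥ w = w ⬝ᵥ S *ᵥ z := by
    intro z w
    rw [dotProduct_mulVec, ← mulVec_transpose, hS, quadricMatrix_transpose, dotProduct_comm]
  have hsum : ∀ i j, (H i + H j) ⬝ᵥ S *ᵥ (H i + H j) = 0 := by
    intro i j
    have := veroneseMatrix_mulVec e (fun u => B (e u)) c (e.symm s(i, j))
    rw [hc0] at this
    simpa only [Equiv.apply_symm_apply, hB, Pi.zero_apply] using this.symm
  have hdiag : ∀ i, H i ⬝ᵥ S *ᵥ H i = 0 := by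
    intro i
    have := hsum i i
    simp only [mulVec_add, dotProduct_add, add_dotProduct] at this
    linarith
  have hH : ∀ i j, H i ⬝ᵥ S *ᵥ H j = 0 := by
    intro i j
    have := hsum i j
    simp only [mulVec_add, dotProduct_add, add_dotProduct] at this
    have h1 := hdiag i
    have h2 := hdiag j
    have h3 := hSsymm (H i) (H j)
    linarith
  have hbasis : ∀ i, ∃ α β : ℝ, Pi.single i 1 = α • H i + β • H none := by
    intro i
    cases i with
    | none =>
      refine ⟨2, 0, ?_⟩
      funext o
      cases o <;> simp [H, b]
    | some k =>
      refine ⟨1, -1, ?_⟩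
      funext o
      cases o <;> simp [H, b, Pi.single_apply, eq_comm]
  apply hc
  funext v
  obtain ⟨i, j, hij⟩ : ∃ i j, e v = s(i, j) := by
    induction h : e v with
    | _ i j => exact ⟨i, j, rfl⟩
  obtain ⟨α, β, h1⟩ := hbasis i
  obtain ⟨α', β', h2⟩ := hbasis j
  have : (Pi.single i 1 : Option (Fin d) → ℝ) ⬝ᵥ S *ᵥ Pi.single j 1 = 0 := by
    rw [h1, h2]
    simp [mulVec_add, mulVec_smul, hH]
  simpa [hS, quadricMatrix, ← hij] using this

theorem IsGenericRealization.isQuadricGeneral [Fintype V] [DecidableEq V] {p : Realization V d}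
    (hp : IsGenericRealization p) : IsQuadricGeneral p :=
  ⟨fun _ hf => hp.det_pointMatrix_ne_zero hf, hp.det_veroneseMatrix_ne_zero⟩

theorem continuous_homog (u : V) (i : Option (Fin d)) :
    Continuous fun p : Realization V d => homog (p u) i := by
  cases i <;> simp only [homog, Option.elim] <;> fun_prop

theorem IsQuadricGeneral.eventually [Fintype V] [DecidableEq V] {p : Realization V d}
    (hp : IsQuadricGeneral p) : ∀ᶠ q in nhds p, IsQuadricGeneral q := by
  have h1 : ∀ f : Option (Fin d) → V, Function.Injective f →
      ∀ᶠ q : Realization V d in nhds p, (pointMatrix f fun u => q u).det ≠ 0 := fun f hf =>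
    (Continuous.matrix_det (continuous_matrix fun i j => continuous_homog (f i) j)).continuousAt
      |>.eventually_ne (hp.1 f hf)
  have h2 : ∀ e : V ≃ Sym2 (Option (Fin d)),
      ∀ᶠ q : Realization V d in nhds p, (veroneseMatrix e fun u => q u).det ≠ 0 := by
    intro e
    have hc : Continuous fun q : Realization V d => (veroneseMatrix e fun u => q u).det := by
      refine Continuous.matrix_det (continuous_matrix fun u v => ?_)
      simp only [veroneseMatrix, of_apply]
      refine continuous_finsetSum _ fun i _ => continuous_finsetSum _ fun j _ => ?_
      split_ifs
      · exact (continuous_homog u i).mul (continuous_homog u j)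
      · exact continuous_const
    exact hc.continuousAt.eventually_ne (hp.2 e)
  filter_upwards [Filter.eventually_all.2 fun f : Option (Fin d) → V =>
    Filter.eventually_all.2 (h1 f), Filter.eventually_all.2 h2] with q hq1 hq2
  exact ⟨hq1, hq2⟩

/-- Any `d + 1` points in general position span in homogeneous coordinates. -/
theorem IsQuadricGeneral.eq_zero_of_dotProduct_eq_zero [Fintype V] [DecidableEq V]
    {p : Realization V d} (hp : IsQuadricGeneral p) {N : Finset V} (hN : d + 1 ≤ N.card)
    {z : Option (Fin d) → ℝ} (hz : ∀ u ∈ N, homog (p u) ⬝ᵥ z = 0) : z = 0 := by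
  obtain ⟨f⟩ : Nonempty (Option (Fin d) ↪ N) := by
    rw [Function.Embedding.nonempty_iff_card_le]
    simpa using hN
  by_contra hne
  refine hp.1 (fun i => f i) (Subtype.val_injective.comp f.injective)
    (exists_mulVec_eq_zero_iff.1 ⟨z, hne, ?_⟩)
  funext i
  rw [pointMatrix_mulVec, hz _ (f i).2]; rfl

/-- If no quadric passes through all the points, then a bilinear form that vanishes on the diagonal
at all the points is alternating. -/
theorem IsQuadricGeneral.add_transpose_eq_zero [Fintype V] [DecidableEq V]
    {p : Realization V d} (hp : IsQuadricGeneral p) (e : V ≃ Sym2 (Option (Fin d)))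
    {T : Matrix (Option (Fin d)) (Option (Fin d)) ℝ}
    (hT : ∀ u, homog (p u) ⬝ᵥ T *ᵥ homog (p u) = 0) : T + Tᵀ = 0 := by
  let c' : Sym2 (Option (Fin d)) → ℝ :=
    Sym2.lift ⟨fun i j => T i j + T j i, fun i j => add_comm _ _⟩
  let c : V → ℝ := fun v => c' (e v)
  have hc : quadricMatrix e c = T + Tᵀ := by
    ext i j
    simp [quadricMatrix, c, c']
  have hc0 : c = 0 := by
    by_contra hne
    refine hp.2 e (exists_mulVec_eq_zero_iff.1 ⟨c, hne, ?_⟩)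
    funext u
    rw [veroneseMatrix_mulVec, hc, add_mulVec, dotProduct_add, hT, zero_add, mulVec_transpose,
      dotProduct_comm, ← dotProduct_mulVec, hT]
    rfl
  rw [← hc, hc0]
  rfl

end

/-! ### Linear infinitesimal motions of bipartite frameworks -/

section

variable {V : Type} {d : ℕ}

/-- The velocity `w u` at the point `p u` as a vector `(-⟪p u, w u⟫, w u)`, which is orthogonal to
the homogeneous coordinates `(1, p u)` of the point. -/
noncomputable def homogVelocity (p w : Realization V d) (u : V) : Option (Fin d) → ℝ := fun o =>
  o.elim (-inner ℝ (p u) (w u)) (w u)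

theorem homog_dotProduct_homogVelocity (p w : Realization V d) (u v : V) :
    homog (p u) ⬝ᵥ homogVelocity p w v = inner ℝ (p u) (w v) - inner ℝ (p v) (w v) := by
  simp only [dotProduct, homog, homogVelocity, Fintype.sum_option, Option.elim, PiLp.inner_apply,
    RCLike.inner_apply, conj_trivial]
  simp only [mul_comm]
  ring

/-- In homogeneous coordinates the first-order length constraint of an edge is bilinear. -/
theorem homog_dotProduct_homogVelocity_add (p w : Realization V d) (u v : V) :
    homog (p u) ⬝ᵥ homogVelocity p w v + homog (p v) ⬝ᵥ homogVelocity p w u =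
      -inner ℝ (p u - p v) (w u - w v) := by
  simp only [homog_dotProduct_homogVelocity, inner_sub_left, inner_sub_right]
  ring

/-- The vertices `u` at which the homogeneous velocity `U u` is the image of the homogeneous
point under the linear map `T`, respectively `-Tᵀ`, according to the colour class of `u`. -/
def linearVelocitySet (c : V → Prop) [DecidablePred c] (p : Realization V d)
    (U : V → Option (Fin d) → ℝ) (T : Matrix (Option (Fin d)) (Option (Fin d)) ℝ) : Set V :=
  {u | U u = (if c u then T else -Tᵀ) *ᵥ homog (p u)}

variable [Fintype V] [DecidableEq V] {p : Realization V d} {c : V → Prop} [DecidablePred c]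
  {U : V → Option (Fin d) → ℝ}

/-- A vertex joined to `d + 1` vertices with linear velocities has the velocity prescribed by the
same linear map. -/
theorem mem_linearVelocitySet (hp : IsQuadricGeneral p)
    {T : Matrix (Option (Fin d)) (Option (Fin d)) ℝ} {N : Finset V} (hN : d + 1 ≤ N.card) {u : V}
    (hNT : ∀ v ∈ N, v ∈ linearVelocitySet c p U T) (hc : ∀ v ∈ N, (c v ↔ ¬ c u))
    (hU : ∀ v ∈ N, homog (p u) ⬝ᵥ U v + homog (p v) ⬝ᵥ U u = 0) :
    u ∈ linearVelocitySet c p U T := by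
  refine sub_eq_zero.1 (hp.eq_zero_of_dotProduct_eq_zero hN fun v hv => ?_)
  have h1 := hU v hv
  have h2 : U v = _ := hNT v hv
  rw [dotProduct_sub, sub_eq_zero]
  rw [h2] at h1
  have h3 : ∀ A : Matrix (Option (Fin d)) (Option (Fin d)) ℝ,
      homog (p v) ⬝ᵥ A *ᵥ homog (p u) = homog (p u) ⬝ᵥ Aᵀ *ᵥ homog (p v) := fun A => by
    rw [mulVec_transpose, dotProduct_comm (homog (p u)), ← dotProduct_mulVec]
  rw [h3, eq_neg_of_add_eq_zero_right h1, ← dotProduct_neg, ← neg_mulVec]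
  congr 2
  by_cases hcu : c u
  · simp [hcu, hc v hv]
  · simp [hcu, hc v hv]

theorem exists_subset_linearVelocitySet_aux (hp : IsQuadricGeneral p) {X Y : Finset V}
    (hX : d + 1 ≤ X.card) (hY : d + 1 ≤ Y.card) (hcX : ∀ u ∈ X, c u) (hcY : ∀ v ∈ Y, ¬ c v)
    (hU : ∀ u ∈ X, ∀ v ∈ Y, homog (p u) ⬝ᵥ U v + homog (p v) ⬝ᵥ U u = 0) :
    ∃ T, (∀ u ∈ X, u ∈ linearVelocitySet c p U T) ∧ ∀ v ∈ Y, v ∈ linearVelocitySet c p U T := by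
  obtain ⟨f⟩ : Nonempty (Option (Fin d) ↪ Y) := by
    rw [Function.Embedding.nonempty_iff_card_le]
    simpa using hY
  let M := pointMatrix (fun i => (f i : V)) fun u => p u
  have hM : IsUnit M.det := isUnit_iff_ne_zero.2
    (hp.1 (fun i => f i) (Subtype.val_injective.comp f.injective))
  let N : Matrix (Option (Fin d)) (Option (Fin d)) ℝ := Matrix.of fun i => -U (f i)
  have hXT : ∀ u ∈ X, u ∈ linearVelocitySet c p U (M⁻¹ * N) := by
    intro u hu
    have h1 : M *ᵥ U u = N *ᵥ homog (p u) := by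
      funext i
      have := hU u hu _ (f i).2
      have h2 : (N *ᵥ homog (p u)) i = -U (f i) ⬝ᵥ homog (p u) := rfl
      rw [pointMatrix_mulVec, h2, neg_dotProduct, dotProduct_comm (U (f i))]
      linarith
    change U u = _
    rw [if_pos (hcX u hu), ← mulVec_mulVec, ← h1, mulVec_mulVec, nonsing_inv_mul _ hM, one_mulVec]
  refine ⟨M⁻¹ * N, hXT, fun v hv => mem_linearVelocitySet hp hX hXT ?_ ?_⟩
  · intro u hu
    simp [hcX u hu, hcY v hv]
  · intro u hu
    rw [add_comm]
    exact hU u hu v hv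

/-- On a complete bipartite subgraph with at least `d + 1` vertices on either side, every
infinitesimal motion is given by a linear map of the homogeneous coordinates. -/
theorem exists_subset_linearVelocitySet (hp : IsQuadricGeneral p) {X Y : Finset V}
    (hX : d + 1 ≤ X.card) (hY : d + 1 ≤ Y.card) (b : Prop) (hcX : ∀ u ∈ X, (c u ↔ b))
    (hcY : ∀ v ∈ Y, (c v ↔ ¬ b))
    (hU : ∀ u ∈ X, ∀ v ∈ Y, homog (p u) ⬝ᵥ U v + homog (p v) ⬝ᵥ U u = 0) :
    ∃ T, (∀ u ∈ X, u ∈ linearVelocitySet c p U T) ∧ ∀ v ∈ Y, v ∈ linearVelocitySet c p U T := by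
  by_cases hb : b
  · exact exists_subset_linearVelocitySet_aux hp hX hY (fun u hu => (hcX u hu).2 hb)
      (fun v hv => (hcY v hv).not.2 (not_not.2 hb)) hU
  · obtain ⟨T, h1, h2⟩ := exists_subset_linearVelocitySet_aux hp hY hX
      (fun v hv => (hcY v hv).2 hb) (fun u hu => (hcX u hu).not.2 hb)
      (fun v hv u hu => by rw [add_comm]; exact hU u hu v hv)
    exact ⟨T, h2, h1⟩

/-- An infinitesimal motion given by a linear map of the homogeneous coordinates is trivial: the
linear map is alternating at all points, hence skew-symmetric. -/
theorem inner_eq_zero_of_forall_mem_linearVelocitySet (hp : IsQuadricGeneral p)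
    (e : V ≃ Sym2 (Option (Fin d))) {w : Realization V d}
    {T : Matrix (Option (Fin d)) (Option (Fin d)) ℝ}
    (hT : ∀ u, u ∈ linearVelocitySet c p (homogVelocity p w) T) (u v : V) :
    inner ℝ (p u - p v) (w u - w v) = 0 := by
  have htr : ∀ x y : Option (Fin d) → ℝ, x ⬝ᵥ Tᵀ *ᵥ y = y ⬝ᵥ T *ᵥ x := fun x y => by
    rw [mulVec_transpose, dotProduct_comm, ← dotProduct_mulVec]
  have hskew : T + Tᵀ = 0 := by
    refine hp.add_transpose_eq_zero e fun u => ?_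
    have h0 := homog_dotProduct_homogVelocity p w u u
    rw [sub_self, show homogVelocity p w u = _ from hT u] at h0
    split_ifs at h0
    · exact h0
    · rwa [neg_mulVec, dotProduct_neg, neg_eq_zero, htr] at h0
  have hU : ∀ u, homogVelocity p w u = T *ᵥ homog (p u) := by
    intro u
    rw [show homogVelocity p w u = _ from hT u, ← eq_neg_of_add_eq_zero_left hskew, ite_self]
  have h := homog_dotProduct_homogVelocity_add p w u v
  rw [hU, hU, ← htr (homog (p u)), ← dotProduct_add, ← add_mulVec, hskew, zero_mulVec,
    dotProduct_zero] at h
  linarith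

end

/-! ### Redundant rigidity of chains -/

section

variable {k : ℕ}

/-- The part `A_i` of the vertex set of a chain. -/
def chainPart (a : Fin k → ℕ) (i : Fin k) : Finset (ChainVertex a) :=
  Finset.univ.map (Function.Embedding.sigmaMk i)

@[simp] theorem mem_chainPart {a : Fin k → ℕ} {i : Fin k} {v : ChainVertex a} :
    v ∈ chainPart a i ↔ v.1 = i := by
  simp only [chainPart, Finset.mem_map, Finset.mem_univ, true_and,
    Function.Embedding.sigmaMk_apply]
  exact ⟨by rintro ⟨x, rfl⟩; rfl, by rintro rfl; exact ⟨v.2, rfl⟩⟩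

@[simp] theorem card_chainPart (a : Fin k → ℕ) (i : Fin k) : (chainPart a i).card = a i := by
  simp [chainPart]

/-- The indices `i` and `j` of two parts are consecutive. -/
def ConsecutiveParts (i j : Fin k) : Prop := (i : ℕ) + 1 = j ∨ (j : ℕ) + 1 = i

/-- The part with index `i` is neither the first nor the last one. -/
def IsInnerPart (i : Fin k) : Prop := 0 < (i : ℕ) ∧ (i : ℕ) + 1 < k

theorem ConsecutiveParts.symm {i j : Fin k} (h : ConsecutiveParts i j) : ConsecutiveParts j i :=
  Or.symm h

theorem ConsecutiveParts.even_iff {i j : Fin k} (h : ConsecutiveParts i j) :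
    (Even (i : ℕ) ↔ ¬ Even (j : ℕ)) := by
  rcases h with h | h <;> rw [← h] <;> simp [Nat.even_add_one]

/-- A property of parts that spreads from each inner part to its neighbours holds for all parts. -/
theorem forall_of_isInnerPart_step {S : Fin k → Prop} {i₀ : Fin k} (h0 : IsInnerPart i₀)
    (hS : S i₀) (step : ∀ i j, IsInnerPart i → S i → ConsecutiveParts i j → S j) (j : Fin k) :
    S j := by
  obtain ⟨h0, h0'⟩ := h0
  have hup : ∀ (n : ℕ) (h : (i₀ : ℕ) + n < k), S ⟨i₀ + n, h⟩ := by
    intro n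
    induction n with
    | zero => exact fun _ => hS
    | succ n ih =>
      exact fun h => step ⟨i₀ + n, by omega⟩ _ ⟨by simp only; omega, by simp only; omega⟩
        (ih (by omega)) (Or.inl rfl)
  have hdown : ∀ (n : ℕ) (_ : n ≤ (i₀ : ℕ)), S ⟨(i₀ : ℕ) - n, by omega⟩ := by
    intro n
    induction n with
    | zero => exact fun _ => hS
    | succ n ih =>
      intro h
      refine step ⟨(i₀ : ℕ) - n, by omega⟩ _ ⟨?_, ?_⟩ (ih (by omega)) (Or.inr ?_) <;>
        simp only <;> omega
  rcases le_total (i₀ : ℕ) j with h | h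
  · convert hup ((j : ℕ) - i₀) (by omega) using 1
    ext; simp only; omega
  · convert hdown ((i₀ : ℕ) - j) (by omega) using 1
    ext; simp only; omega

variable {d : ℕ} {a : Fin k → ℕ}

/-- The infinitesimal motions of a chain without the edge `xy` are linear in the homogeneous
coordinates, if either `x` is in an end part and the part of `y` has a spare vertex, or both are in
inner parts and the part of `x` has a spare vertex. -/
theorem exists_forall_mem_linearVelocitySet (hk : 4 ≤ k) (ha : ∀ i, 0 < a i)
    (hinner : ∀ i, IsInnerPart i → d + 1 ≤ a i) {p : Realization (ChainVertex a) d}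
    (hp : IsQuadricGeneral p) {x y : ChainVertex a} (hxy : ConsecutiveParts x.1 y.1)
    (hspare : (¬ IsInnerPart x.1 ∧ d + 2 ≤ a y.1) ∨
      (IsInnerPart x.1 ∧ IsInnerPart y.1 ∧ d + 2 ≤ a x.1))
    {U : ChainVertex a → Option (Fin d) → ℝ}
    (hU : ∀ u v, ConsecutiveParts u.1 v.1 → s(u, v) ≠ s(x, y) →
      homog (p u) ⬝ᵥ U v + homog (p v) ⬝ᵥ U u = 0) :
    ∃ T, ∀ u, u ∈ linearVelocitySet (fun u : ChainVertex a => Even (u.1 : ℕ)) p U T := by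
  -- A part spreads linearity to the next one, unless the missing edge joins the two.
  have spread : ∀ T, ∀ i j, d + 1 ≤ a i → ConsecutiveParts i j →
      (∀ u, u.1 = i → u ∈ linearVelocitySet (fun u : ChainVertex a => Even (u.1 : ℕ)) p U T) →
      (∀ u v : ChainVertex a, u.1 = i → v.1 = j → s(v, u) ≠ s(x, y)) →
      ∀ u, u.1 = j → u ∈ linearVelocitySet (fun u : ChainVertex a => Even (u.1 : ℕ)) p U T := by
    intro T i j hi hij hT hne u hu
    refine mem_linearVelocitySet hp (N := chainPart a i) (by simpa using hi) ?_ ?_ ?_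
    · intro v hv
      exact hT v (mem_chainPart.1 hv)
    · intro v hv
      rw [mem_chainPart.1 hv, hu]
      exact hij.even_iff
    · intro v hv
      rw [mem_chainPart] at hv
      exact hU u v (by rw [hv, hu]; exact hij.symm) (hne v u hv hu)
  have hxy' : x.1 ≠ y.1 := by
    intro h
    rw [h] at hxy
    rcases hxy with h | h <;> omega
  rcases hspare with ⟨hx, hy⟩ | ⟨hx, hy, hax⟩
  · -- The part of `y` and its other neighbour carry a complete bipartite graph.
    obtain ⟨l, hl, hyl, hlx⟩ : ∃ l, IsInnerPart l ∧ ConsecutiveParts y.1 l ∧ l ≠ x.1 := by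
      simp only [IsInnerPart, not_and_or, not_lt] at hx
      have := x.1.2
      rcases hxy with h | h
      · exact ⟨⟨y.1 + 1, by omega⟩, ⟨by simp, by simp only; omega⟩, Or.inl rfl, by
          rw [ne_eq, Fin.ext_iff]; simp only; omega⟩
      · exact ⟨⟨y.1 - 1, by omega⟩, ⟨by simp only; omega, by simp only; omega⟩,
          Or.inr (by simp only; omega), by rw [ne_eq, Fin.ext_iff]; simp only; omega⟩
    have hyin : IsInnerPart y.1 := by
      simp only [IsInnerPart, not_and_or, not_lt] at hx
      have := x.1.2
      unfold IsInnerPart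
      rcases hxy with h | h <;> omega
    obtain ⟨T, hT1, -⟩ := exists_subset_linearVelocitySet hp (X := chainPart a y.1)
      (Y := chainPart a l) (U := U) (c := fun u : ChainVertex a => Even (u.1 : ℕ))
      (by simpa using hinner _ hyin) (by simpa using hinner _ hl) (Even (y.1 : ℕ))
      (fun u hu => by rw [mem_chainPart.1 hu])
      (fun v hv => by rw [mem_chainPart.1 hv]; exact hyl.symm.even_iff)
      (fun u hu v hv => by
        rw [mem_chainPart] at hu hv
        refine hU u v (by rw [hu, hv]; exact hyl) fun h => ?_
        rcases Sym2.eq_iff.1 h with ⟨rfl, rfl⟩ | ⟨rfl, rfl⟩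
        · exact hxy' hu
        · exact hlx hv.symm)
    refine ⟨T, fun u => forall_of_isInnerPart_step
      (S := fun i => ∀ u : ChainVertex a, u.1 = i → u ∈ linearVelocitySet _ p U T) hyin
      (fun u hu => hT1 u (by simpa using hu)) ?_ u.1 u rfl⟩
    intro i j hi hT hij
    by_cases hpair : i = y.1 ∧ j = x.1
    · obtain ⟨rfl, rfl⟩ := hpair
      intro u hu
      refine mem_linearVelocitySet hp (N := (chainPart a y.1).erase y) ?_ ?_ ?_ ?_
      · rw [Finset.card_erase_of_mem (by simp), card_chainPart]; omega
      · intro v hv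
        exact hT v (by simpa using Finset.mem_of_mem_erase hv)
      · intro v hv
        rw [mem_chainPart.1 (Finset.mem_of_mem_erase hv), hu]
        exact hij.even_iff
      · intro v hv
        have hv' := mem_chainPart.1 (Finset.mem_of_mem_erase hv)
        refine hU u v (by rw [hv', hu]; exact hij.symm) fun h => ?_
        rcases Sym2.eq_iff.1 h with ⟨rfl, rfl⟩ | ⟨rfl, rfl⟩
        · exact Finset.ne_of_mem_erase hv rfl
        · exact hxy' hv'
    · refine spread T i j (hinner i hi) hij hT fun u v hu hv h => ?_
      rcases Sym2.eq_iff.1 h with ⟨rfl, rfl⟩ | ⟨rfl, rfl⟩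
      · exact hpair ⟨hu.symm, hv.symm⟩
      · exact hx (hu ▸ hi)
  · -- Leaving out `x` only, the parts of `x` and `y` carry a complete bipartite graph; the part on
    -- the other side of `x` then supplies the missing neighbour of `x`.
    obtain ⟨l, hxl, hly⟩ : ∃ l, ConsecutiveParts x.1 l ∧ l ≠ y.1 := by
      obtain ⟨h1, h2⟩ := hx
      rcases hxy with h | h
      · exact ⟨⟨x.1 - 1, by omega⟩, Or.inr (by simp only; omega), by
          rw [ne_eq, Fin.ext_iff]; simp only; omega⟩
      · exact ⟨⟨x.1 + 1, by omega⟩, Or.inl rfl, by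
          rw [ne_eq, Fin.ext_iff]; simp only; omega⟩
    have hX : d + 1 ≤ ((chainPart a x.1).erase x).card := by
      rw [Finset.card_erase_of_mem (by simp), card_chainPart]; omega
    obtain ⟨T, hT1, hT2⟩ := exists_subset_linearVelocitySet hp (X := (chainPart a x.1).erase x)
      (Y := chainPart a y.1) (U := U) (c := fun u : ChainVertex a => Even (u.1 : ℕ))
      hX (by simpa using hinner _ hy) (Even (x.1 : ℕ))
      (fun u hu => by rw [mem_chainPart.1 (Finset.mem_of_mem_erase hu)])
      (fun v hv => by rw [mem_chainPart.1 hv]; exact hxy.symm.even_iff)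
      (fun u hu v hv => by
        have hu' := mem_chainPart.1 (Finset.mem_of_mem_erase hu)
        rw [mem_chainPart] at hv
        refine hU u v (by rw [hu', hv]; exact hxy) fun h => ?_
        rcases Sym2.eq_iff.1 h with ⟨rfl, rfl⟩ | ⟨rfl, rfl⟩
        · exact Finset.ne_of_mem_erase hu rfl
        · exact hxy' hu'.symm)
    have hTl : ∀ u, u.1 = l →
        u ∈ linearVelocitySet (fun u : ChainVertex a => Even (u.1 : ℕ)) p U T := by
      intro u hu
      refine mem_linearVelocitySet hp hX hT1 ?_ ?_
      · intro v hv
        rw [mem_chainPart.1 (Finset.mem_of_mem_erase hv), hu]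
        exact hxl.even_iff
      · intro v hv
        have hv' := mem_chainPart.1 (Finset.mem_of_mem_erase hv)
        refine hU u v (by rw [hv', hu]; exact hxl.symm) fun h => ?_
        rcases Sym2.eq_iff.1 h with ⟨rfl, rfl⟩ | ⟨rfl, rfl⟩
        · exact hxy' hv'.symm
        · exact hly hu.symm
    have hTx : x ∈ linearVelocitySet (fun u : ChainVertex a => Even (u.1 : ℕ)) p U T := by
      refine mem_linearVelocitySet hp (N := chainPart a l ∪ (chainPart a y.1).erase y) ?_ ?_ ?_ ?_
      · rw [Finset.card_union_of_disjoint, Finset.card_erase_of_mem (by simp), card_chainPart,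
          card_chainPart]
        · have := hinner _ hy
          have := ha l
          omega
        · refine Finset.disjoint_left.2 fun v hv hv' => hly ?_
          rw [← mem_chainPart.1 hv, mem_chainPart.1 (Finset.mem_of_mem_erase hv')]
      · intro v hv
        rcases Finset.mem_union.1 hv with hv | hv
        · exact hTl v (mem_chainPart.1 hv)
        · exact hT2 v (Finset.mem_of_mem_erase hv)
      · intro v hv
        rcases Finset.mem_union.1 hv with hv | hv
        · rw [mem_chainPart.1 hv]; exact hxl.symm.even_iff
        · rw [mem_chainPart.1 (Finset.mem_of_mem_erase hv)]
          exact hxy.symm.even_iff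
      · intro v hv
        rcases Finset.mem_union.1 hv with hv | hv
        · have hv' := mem_chainPart.1 hv
          refine hU x v (by rw [hv']; exact hxl) fun h => ?_
          rcases Sym2.eq_iff.1 h with ⟨-, rfl⟩ | ⟨h, -⟩
          · exact hly hv'.symm
          · exact hxy' (by rw [← h])
        · have hv' := mem_chainPart.1 (Finset.mem_of_mem_erase hv)
          refine hU x v (by rw [hv']; exact hxy) fun h => ?_
          rcases Sym2.eq_iff.1 h with ⟨-, rfl⟩ | ⟨h, -⟩
          · exact Finset.ne_of_mem_erase hv rfl
          · exact hxy' (by rw [← h])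
    have hTx' : ∀ u, u.1 = x.1 →
        u ∈ linearVelocitySet (fun u : ChainVertex a => Even (u.1 : ℕ)) p U T := by
      intro u hu
      by_cases hux : u = x
      · rwa [hux]
      · exact hT1 u (Finset.mem_erase.2 ⟨hux, mem_chainPart.2 hu⟩)
    have hTy' : ∀ u, u.1 = y.1 →
        u ∈ linearVelocitySet (fun u : ChainVertex a => Even (u.1 : ℕ)) p U T := fun u hu =>
      hT2 u (mem_chainPart.2 hu)
    refine ⟨T, fun u => forall_of_isInnerPart_step
      (S := fun i => ∀ u : ChainVertex a, u.1 = i → u ∈ linearVelocitySet _ p U T) hx hTx'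
      ?_ u.1 u rfl⟩
    intro i j hi hT hij
    by_cases hjx : j = x.1
    · rwa [hjx]
    by_cases hjy : j = y.1
    · rwa [hjy]
    refine spread T i j (hinner i hi) hij hT fun u v hu hv h => ?_
    rcases Sym2.eq_iff.1 h with ⟨rfl, rfl⟩ | ⟨rfl, rfl⟩
    · exact hjx hv.symm
    · exact hjy hv.symm

/-- Under the two conditions on the sizes of the parts, a chain in general position remains
locally rigid without any one of its edges. -/
theorem isRedundantlyRigid_chainGraph (hk : 4 ≤ k) (ha : ∀ i, 0 < a i)
    (hcard : ∑ i, a i = (d + 2).choose 2) (hinner : ∀ i, IsInnerPart i → d + 1 ≤ a i)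
    (hend : ∀ i j, ConsecutiveParts i j → ¬ IsInnerPart i → d + 2 ≤ a j)
    (hno : ∀ i j, ConsecutiveParts i j → d + 2 ≤ a i ∨ d + 2 ≤ a j ∨
      ¬ IsInnerPart i ∨ ¬ IsInnerPart j)
    {p : Realization (ChainVertex a) d} (hp : IsQuadricGeneral p) :
    IsRedundantlyRigid (chainGraph a) p := by
  intro e he
  induction e with
  | _ x y =>
  have hxy : ConsecutiveParts x.1 y.1 := he
  refine isLocallyRigid_of_eventually _ _ (hp.eventually.mono fun q hq w hw => ?_)
  have hE : ∀ u v : ChainVertex a, ConsecutiveParts u.1 v.1 → s(u, v) ≠ s(x, y) →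
      homog (q u) ⬝ᵥ homogVelocity q w v + homog (q v) ⬝ᵥ homogVelocity q w u = 0 := by
    intro u v huv hne
    rw [homog_dotProduct_homogVelocity_add, hw u v, neg_zero]
    rw [SimpleGraph.deleteEdges_adj]
    exact ⟨huv, hne⟩
  obtain ⟨T, hT⟩ : ∃ T, ∀ u, u ∈ linearVelocitySet (fun u : ChainVertex a => Even (u.1 : ℕ)) q
      (homogVelocity q w) T := by
    have hE' : ∀ u v : ChainVertex a, ConsecutiveParts u.1 v.1 → s(u, v) ≠ s(y, x) →
        homog (q u) ⬝ᵥ homogVelocity q w v + homog (q v) ⬝ᵥ homogVelocity q w u = 0 := by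
      rwa [Sym2.eq_swap]
    by_cases hx : IsInnerPart x.1
    · by_cases hy : IsInnerPart y.1
      · rcases hno _ _ hxy with h | h | h | h
        · exact exists_forall_mem_linearVelocitySet hk ha hinner hq hxy (Or.inr ⟨hx, hy, h⟩) hE
        · exact exists_forall_mem_linearVelocitySet hk ha hinner hq hxy.symm
            (Or.inr ⟨hy, hx, h⟩) hE'
        · exact absurd hx h
        · exact absurd hy h
      · exact exists_forall_mem_linearVelocitySet hk ha hinner hq hxy.symm
          (Or.inl ⟨hy, hend _ _ hxy.symm hy⟩) hE'
    · exact exists_forall_mem_linearVelocitySet hk ha hinner hq hxy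
        (Or.inl ⟨hx, hend _ _ hxy hx⟩) hE
  have e : ChainVertex a ≃ Sym2 (Option (Fin d)) := Fintype.equivOfCardEq <| by
    rw [Sym2.card, Fintype.card_sigma]
    simpa using hcard
  exact inner_eq_zero_of_forall_mem_linearVelocitySet hq e hT

end

/-! ### Flexings from solutions of the edge equations -/

section

variable {V : Type} {d : ℕ}

/-- A homogeneous vector orthogonal to the homogeneous coordinates of the point is the homogeneous
velocity of its affine part. -/
theorem homogVelocity_eq {q : Realization V d} {U : V → Option (Fin d) → ℝ} {u : V}
    (h : homog (q u) ⬝ᵥ U u = 0) :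
    homogVelocity q (fun v => WithLp.toLp 2 fun j => U v (some j)) u = U u := by
  simp only [dotProduct, homog, Fintype.sum_option, Option.elim, one_mul] at h
  funext o
  cases o with
  | none =>
    simp only [homogVelocity, Option.elim, PiLp.inner_apply, RCLike.inner_apply, conj_trivial]
    simp only [mul_comm (U u _)]
    linarith
  | some j => rfl

/-- A vector orthogonal to all of the `d + 1` points `q (f i)` but `q (f none)`. -/
def dualVector (f : Option (Fin d) → V) (q : Realization V d) : Option (Fin d) → ℝ :=
  (pointMatrix f fun u => q u).adjugate *ᵥ Pi.single none 1

theorem homog_dotProduct_dualVector (f : Option (Fin d) → V) (q : Realization V d)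
    (i : Option (Fin d)) : homog (q (f i)) ⬝ᵥ dualVector f q =
      if i = none then (pointMatrix f fun u => q u).det else 0 := by
  rw [← pointMatrix_mulVec f (fun u => q u), dualVector, mulVec_mulVec, mul_adjugate, smul_mulVec,
    one_mulVec]
  simp [Pi.single_apply]

variable [Fintype V]

theorem contDiff_homog (u : V) (i : Option (Fin d)) :
    ContDiff ℝ 1 fun q : Realization V d => homog (q u) i := by
  cases i with
  | none => exact contDiff_const
  | some j =>
    change ContDiff ℝ 1 fun q : Realization V d => q u j
    fun_prop

theorem contDiff_det {E ι : Type} [NormedAddCommGroup E] [NormedSpace ℝ E] [Fintype ι]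
    [DecidableEq ι] {M : E → Matrix ι ι ℝ} (hM : ∀ i j, ContDiff ℝ 1 fun q => M q i j) :
    ContDiff ℝ 1 fun q => (M q).det := by
  simp only [det_apply']
  exact ContDiff.sum fun σ _ => contDiff_const.mul (contDiff_prod fun i _ => hM _ _)

theorem contDiff_adjugate {E ι : Type} [NormedAddCommGroup E] [NormedSpace ℝ E] [Fintype ι]
    [DecidableEq ι] {M : E → Matrix ι ι ℝ} (hM : ∀ i j, ContDiff ℝ 1 fun q => M q i j) (i j : ι) :
    ContDiff ℝ 1 fun q => (M q).adjugate i j := by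
  simp only [adjugate_apply]
  refine contDiff_det fun k l => ?_
  by_cases hk : k = j
  · subst hk
    simpa only [updateRow_self] using contDiff_const
  · simpa only [updateRow_ne hk] using hM k l

theorem contDiff_mulVec {E ι κ : Type} [NormedAddCommGroup E] [NormedSpace ℝ E] [Fintype κ]
    {M : E → Matrix ι κ ℝ} {v : E → κ → ℝ} (hM : ∀ i j, ContDiff ℝ 1 fun q => M q i j)
    (hv : ∀ j, ContDiff ℝ 1 fun q => v q j) (i : ι) : ContDiff ℝ 1 fun q => (M q *ᵥ v q) i :=
  ContDiff.sum fun j _ => (hM i j).mul (hv j)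

theorem contDiff_dotProduct {E κ : Type} [NormedAddCommGroup E] [NormedSpace ℝ E] [Fintype κ]
    {v w : E → κ → ℝ} (hv : ∀ j, ContDiff ℝ 1 fun q => v q j)
    (hw : ∀ j, ContDiff ℝ 1 fun q => w q j) : ContDiff ℝ 1 fun q => v q ⬝ᵥ w q :=
  ContDiff.sum fun j _ => (hv j).mul (hw j)

theorem contDiff_veroneseMatrix (e : V ≃ Sym2 (Option (Fin d))) (u v : V) :
    ContDiff ℝ 1 fun q : Realization V d => veroneseMatrix e (fun u => q u) u v := by
  simp only [veroneseMatrix, of_apply]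
  refine ContDiff.sum fun i _ => ContDiff.sum fun j _ => ?_
  split_ifs
  · exact (contDiff_homog u i).mul (contDiff_homog u j)
  · exact contDiff_const

/-- Let `z` be a solution, depending smoothly on the realization, of the bilinear edge equations of
a bipartite graph `H` that violates the equation of the pair `xy`. Subtracting from `z` the linear
solution `S` given by a symmetric matrix, where the quadric of `S` is chosen so as to correct the
diagonal `homog (q u) ⬝ᵥ z u`, turns it into a field of infinitesimal motions of `H`. The adjugate
in place of the inverse of the Veronese matrix keeps this field smooth everywhere. -/
theorem not_isLocallyRigid_of_edge_equations [DecidableEq V] (e : V ≃ Sym2 (Option (Fin d)))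
    (c : V → Prop) [DecidablePred c] (H : SimpleGraph V) (hHc : ∀ u v, H.Adj u v → (c v ↔ ¬ c u))
    (z : Realization V d → V → Option (Fin d) → ℝ) (hz : ∀ u i, ContDiff ℝ 1 fun q => z q u i)
    (hH : ∀ q u v, H.Adj u v → homog (q u) ⬝ᵥ z q v = homog (q v) ⬝ᵥ z q u)
    {p : Realization V d} (hp : (veroneseMatrix e fun u => p u).det ≠ 0) {x y : V}
    (hc : c y ↔ ¬ c x) (hxy : homog (p x) ⬝ᵥ z p y ≠ homog (p y) ⬝ᵥ z p x) :
    ¬ IsLocallyRigid H p := by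
  let M : Realization V d → Matrix V V ℝ := fun q => veroneseMatrix e fun u => q u
  let C : Realization V d → V → ℝ := fun q => (M q).adjugate *ᵥ fun u => homog (q u) ⬝ᵥ z q u
  let S : Realization V d → Matrix (Option (Fin d)) (Option (Fin d)) ℝ := fun q =>
    quadricMatrix e (C q)
  let Q : Realization V d → V → Option (Fin d) → ℝ := fun q u =>
    (M q).det • z q u - S q *ᵥ homog (q u)
  let σ : V → ℝ := fun u => if c u then 1 else -1
  let U : Realization V d → V → Option (Fin d) → ℝ := fun q u => σ u • Q q u
  let w : Realization V d → Realization V d := fun q u => WithLp.toLp 2 fun j => U q u (some j)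
  have hSsymm : ∀ q (r s : Option (Fin d) → ℝ), r ⬝ᵥ S q *ᵥ s = s ⬝ᵥ S q *ᵥ r := by
    intro q r s
    rw [dotProduct_mulVec, ← mulVec_transpose, quadricMatrix_transpose, dotProduct_comm]
  have hQ : ∀ q u, homog (q u) ⬝ᵥ Q q u = 0 := by
    intro q u
    have h1 : homog (q u) ⬝ᵥ S q *ᵥ homog (q u) = (M q).det * (homog (q u) ⬝ᵥ z q u) := by
      rw [← veroneseMatrix_mulVec e (fun u => q u)]
      change (M q *ᵥ (M q).adjugate *ᵥ _) u = _
      rw [mulVec_mulVec, mul_adjugate, smul_mulVec, one_mulVec]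
      rfl
    rw [dotProduct_sub, h1, dotProduct_smul, smul_eq_mul, sub_self]
  have hU : ∀ q u, homogVelocity q (w q) u = U q u := fun q u => homogVelocity_eq <| by
    rw [dotProduct_smul, hQ, smul_zero]
  have hedge : ∀ q u v, (c v ↔ ¬ c u) → inner ℝ (q u - q v) (w q u - w q v) =
      σ u * ((M q).det * (homog (q u) ⬝ᵥ z q v - homog (q v) ⬝ᵥ z q u)) := by
    intro q u v huv
    have hσ : σ v = -σ u := by
      by_cases hu : c u <;> simp [σ, huv, hu]
    rw [← neg_inj, ← homog_dotProduct_homogVelocity_add, hU, hU]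
    simp only [U, Q, hσ, dotProduct_smul, dotProduct_sub, smul_eq_mul]
    rw [hSsymm q (homog (q v))]
    ring
  refine not_isLocallyRigid_of_contDiff H p w ?_ (fun q u v huv => ?_) x y ?_
  · refine contDiff_pi.2 fun u => contDiff_euclidean.2 fun j => ?_
    have hC : ∀ v, ContDiff ℝ 1 fun q => C q v :=
      contDiff_mulVec (contDiff_adjugate (contDiff_veroneseMatrix e))
        fun u => contDiff_dotProduct (contDiff_homog u) (hz u)
    exact contDiff_const.mul (((contDiff_det (contDiff_veroneseMatrix e)).mul (hz u _)).sub
      (contDiff_mulVec (fun i j => hC _) (contDiff_homog u) _))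
  · rw [hedge q u v (hHc u v huv), hH q u v huv, sub_self, mul_zero, mul_zero]
  · rw [hedge p x y hc]
    refine mul_ne_zero ?_ (mul_ne_zero hp (sub_ne_zero.2 hxy))
    simp only [σ]
    split_ifs <;> norm_num

theorem contDiff_dualVector (f : Option (Fin d) → V) (j : Option (Fin d)) :
    ContDiff ℝ 1 fun q : Realization V d => dualVector f q j :=
  contDiff_mulVec
    (contDiff_adjugate (M := fun q : Realization V d => pointMatrix f fun u => q u)
      fun i j => contDiff_homog (f i) j)
    (v := fun _ => Pi.single none 1) (fun _ => contDiff_const) j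

/-- In a bipartite graph with `(d + 2).choose 2` vertices, no edge at a vertex of degree `d + 1` is
redundant. -/
theorem not_isLocallyRigid_deleteEdges_of_neighbors [DecidableEq V]
    (e : V ≃ Sym2 (Option (Fin d))) (c : V → Prop) [DecidablePred c] {G : SimpleGraph V}
    (hGc : ∀ u v, G.Adj u v → (c v ↔ ¬ c u)) {p : Realization V d} (hp : IsQuadricGeneral p)
    {x : V} {f : Option (Fin d) → V} (hf : Function.Injective f)
    (hx : ∀ u, G.Adj x u ↔ u ∈ Set.range f) :
    ¬ IsLocallyRigid (G.deleteEdges {s(x, f none)}) p := by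
  have hxf : G.Adj x (f none) := (hx _).2 ⟨none, rfl⟩
  let z : Realization V d → V → Option (Fin d) → ℝ := fun q u =>
    if u = x then dualVector f q else 0
  have key : ∀ q u, (G.deleteEdges {s(x, f none)}).Adj x u → homog (q u) ⬝ᵥ z q x = 0 := by
    intro q u hu
    rw [SimpleGraph.deleteEdges_adj] at hu
    obtain ⟨i, rfl⟩ := (hx u).1 hu.1
    simp only [z, if_true, homog_dotProduct_dualVector]
    rw [if_neg]
    rintro rfl
    exact hu.2 rfl
  refine not_isLocallyRigid_of_edge_equations e c _
    (fun u v huv => hGc u v (SimpleGraph.deleteEdges_adj.1 huv).1) z (fun u i => ?_)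
    (fun q u v huv => ?_) (hp.2 e) (hGc x (f none) hxf) ?_
  · by_cases hu : u = x
    · simpa only [z, if_pos hu] using contDiff_dualVector f i
    · simpa only [z, if_neg hu] using contDiff_const
  · by_cases hu : u = x
    · subst hu
      have hv : v ≠ u := huv.ne'
      rw [key q v huv]
      simp [z, hv]
    · by_cases hv : v = x
      · subst hv
        rw [key q u huv.symm]
        simp [z, hu]
      · simp [z, hu, hv]
  · have h1 : z p (f none) = 0 := if_neg hxf.ne'
    have h2 : z p x = dualVector f p := if_pos rfl
    rw [h1, h2, dotProduct_zero, homog_dotProduct_dualVector, if_pos rfl]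
    exact (hp.1 f hf).symm

end

/-! ### Edges of chains that are not redundant -/

section

variable {k d : ℕ} {a : Fin k → ℕ}

theorem exists_injective_range_eq_chainPart {i : Fin k} (hi : a i = d + 1) :
    ∃ f : Option (Fin d) → ChainVertex a, Function.Injective f ∧
      ∀ u, u.1 = i ↔ u ∈ Set.range f := by
  have h : Fintype.card (Option (Fin d)) = Fintype.card (chainPart a i) := by
    rw [Fintype.card_coe, card_chainPart, hi, Fintype.card_option, Fintype.card_fin]
  let g := Fintype.equivOfCardEq h
  refine ⟨fun m => g m, Subtype.val_injective.comp g.injective, fun u => ⟨fun hu => ?_, ?_⟩⟩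
  · exact ⟨g.symm ⟨u, mem_chainPart.2 hu⟩, by simp⟩
  · rintro ⟨m, rfl⟩
    exact mem_chainPart.1 (g m).2

/-- No edge between two consecutive parts of size `d + 1` is redundant: the motions linear in the
homogeneous coordinates on the two sides of the edge may differ by a matrix of rank one. -/
theorem exists_not_isLocallyRigid_of_parts_eq
    (e : ChainVertex a ≃ Sym2 (Option (Fin d))) {i j : Fin k}
    (hij : (i : ℕ) + 1 = j) (hi : a i = d + 1) (hj : a j = d + 1)
    {p : Realization (ChainVertex a) d} (hp : IsQuadricGeneral p) :
    ∃ x y, (chainGraph a).Adj x y ∧ ¬ IsLocallyRigid ((chainGraph a).deleteEdges {s(x, y)}) p := by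
  obtain ⟨f, hf, hfi⟩ := exists_injective_range_eq_chainPart hi
  obtain ⟨g, hg, hgj⟩ := exists_injective_range_eq_chainPart hj
  have hx : (f none).1 = i := (hfi _).2 ⟨none, rfl⟩
  have hy : (g none).1 = j := (hgj _).2 ⟨none, rfl⟩
  have hadj : (chainGraph a).Adj (f none) (g none) := Or.inl (by rw [hx, hy]; exact hij)
  refine ⟨f none, g none, hadj, ?_⟩
  let c : ChainVertex a → Prop := fun u => Even (u.1 : ℕ)
  let α := dualVector (V := ChainVertex a) (d := d) f
  let β := dualVector (V := ChainVertex a) (d := d) g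
  let z : Realization (ChainVertex a) d → ChainVertex a → Option (Fin d) → ℝ := fun q u =>
    if u.1 ≤ i then
      if (Even (u.1 : ℕ) ↔ Even (i : ℕ)) then (homog (q u) ⬝ᵥ α q) • β q
      else (homog (q u) ⬝ᵥ β q) • α q
    else 0
  have hstep : ∀ q, ∀ u v : ChainVertex a, (u.1 : ℕ) + 1 = v.1 → s(u, v) ≠ s(f none, g none) →
      homog (q u) ⬝ᵥ z q v = homog (q v) ⬝ᵥ z q u := by
    intro q u v huv hne
    by_cases hv : v.1 ≤ i
    · have hu : u.1 ≤ i := by rw [Fin.le_def] at hv ⊢; omega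
      have hpar : (Even (v.1 : ℕ) ↔ ¬ Even (u.1 : ℕ)) := by rw [← huv, Nat.even_add_one]
      simp only [z, if_pos hv, if_pos hu, hpar]
      by_cases h1 : Even (u.1 : ℕ) <;> by_cases h2 : Even (i : ℕ) <;>
        simp [h1, h2, mul_comm]
    · have hzv : z q v = 0 := if_neg hv
      rw [hzv, dotProduct_zero]
      by_cases hu : u.1 ≤ i
      · have hui : u.1 = i := by
          rw [Fin.ext_iff]
          rw [Fin.le_def] at hu hv
          omega
        have hvj : v.1 = j := by rw [Fin.ext_iff, ← huv, ← hij, hui]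
        obtain ⟨m, rfl⟩ := (hfi u).1 hui
        obtain ⟨n, rfl⟩ := (hgj v).1 hvj
        have hzu : z q (f m) = (homog (q (f m)) ⬝ᵥ α q) • β q := by
          simp only [z, hui, le_refl, if_true]
        rw [hzu, dotProduct_smul, homog_dotProduct_dualVector, homog_dotProduct_dualVector]
        by_cases hm : m = none
        · have hn : n ≠ none := by
            rintro rfl
            exact hne (by rw [hm])
          simp [hn]
        · simp [hm]
      · have hzu : z q u = 0 := if_neg hu
        rw [hzu, dotProduct_zero]
  refine not_isLocallyRigid_of_edge_equations e c _
    (fun u v huv => ?_) z (fun u m => ?_) (fun q u v huv => ?_) (hp.2 e) (x := f none)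
    (y := g none) ?_ ?_
  · exact ConsecutiveParts.even_iff
      (ConsecutiveParts.symm (SimpleGraph.deleteEdges_adj.1 huv).1)
  · have hα := contDiff_dualVector (V := ChainVertex a) (d := d) f
    have hβ := contDiff_dualVector (V := ChainVertex a) (d := d) g
    simp only [z]
    split_ifs
    · exact (contDiff_dotProduct (contDiff_homog u) hα).mul (hβ m)
    · exact (contDiff_dotProduct (contDiff_homog u) hβ).mul (hα m)
    · exact contDiff_const
  · obtain ⟨h1, h2⟩ := SimpleGraph.deleteEdges_adj.1 huv
    rcases h1 with h1 | h1
    · exact hstep q u v h1 h2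
    · exact (hstep q v u h1 (by rwa [Sym2.eq_swap])).symm
  · exact ConsecutiveParts.even_iff (ConsecutiveParts.symm hadj)
  · have h1 : z p (g none) = 0 := if_neg (by rw [hy, Fin.le_def]; omega)
    have h2 : z p (f none) = (homog (p (f none)) ⬝ᵥ α p) • β p := by
      simp only [z, hx, le_refl, if_true]
    rw [h1, h2, dotProduct_zero, dotProduct_smul, homog_dotProduct_dualVector,
      homog_dotProduct_dualVector, if_pos rfl, if_pos rfl]
    exact (mul_ne_zero (hp.1 f hf) (hp.1 g hg)).symm

/-- The inner parts of an `n`-connected chain have at least `n` vertices, since each of them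
separates the first part from the last one. -/
theorem le_of_isVertexConnected {n : ℕ} (ha : ∀ i, 0 < a i)
    (hconn : IsVertexConnected n (chainGraph a)) {i : Fin k} (hi : IsInnerPart i) : n ≤ a i := by
  by_contra! hlt
  have hcon := hconn.2 (chainPart a i) (by simpa using hlt)
  obtain ⟨hi0, hi1⟩ := hi
  let s : Set (ChainVertex a) := {v | v ∉ chainPart a i}
  let u : s := ⟨⟨⟨0, by omega⟩, ⟨0, ha _⟩⟩, by
    simp only [s, Set.mem_ofPred_eq, mem_chainPart, Fin.ext_iff]; omega⟩
  let v : s := ⟨⟨⟨k - 1, by omega⟩, ⟨0, ha _⟩⟩, by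
    simp only [s, Set.mem_ofPred_eq, mem_chainPart, Fin.ext_iff]; omega⟩
  obtain ⟨w⟩ := hcon.preconnected u v
  have hw : ∀ {u v : s}, ((chainGraph a).induce s).Walk u v →
      (u.1.1 : ℕ) < i → (v.1.1 : ℕ) < i := by
    intro u v w
    induction w with
    | nil => exact id
    | @cons x y _ h _ ih =>
      intro hx
      refine ih ?_
      have hy : y.1.1 ≠ i := fun h => y.2 (mem_chainPart.2 h)
      rw [ne_eq, Fin.ext_iff] at hy
      have h' : (x.1.1 : ℕ) + 1 = y.1.1 ∨ (y.1.1 : ℕ) + 1 = x.1.1 := h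
      omega
  have := hw w hi0
  simp only [v] at this
  omega

/-- If the part next to an end part has `d + 1` vertices, then the chain is not redundantly
rigid. -/
theorem not_isRedundantlyRigid_of_end_part (ha : ∀ i, 0 < a i)
    (e : ChainVertex a ≃ Sym2 (Option (Fin d))) {i j : Fin k}
    (hij : ∀ l, ConsecutiveParts i l ↔ l = j) (hj : a j = d + 1)
    {p : Realization (ChainVertex a) d} (hp : IsQuadricGeneral p) :
    ¬ IsRedundantlyRigid (chainGraph a) p := by
  intro hr
  obtain ⟨f, hf, hfj⟩ := exists_injective_range_eq_chainPart hj
  let x : ChainVertex a := ⟨i, ⟨0, ha i⟩⟩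
  have hx : ∀ u, (chainGraph a).Adj x u ↔ u ∈ Set.range f := fun u =>
    (hij u.1).trans (hfj u)
  exact not_isLocallyRigid_deleteEdges_of_neighbors e (fun u => Even (u.1 : ℕ))
    (fun u v huv => ConsecutiveParts.even_iff (ConsecutiveParts.symm huv)) hp hf hx
    (hr _ ((hx (f none)).2 ⟨none, rfl⟩))

end

/-! ### The characterization of redundantly rigid chains -/

theorem lemma4p2 (d k : ℕ) (hk : 4 ≤ k) (a : Fin k → ℕ) (ha : ∀ i, 0 < a i)
    (hcard : ∑ i, a i = (d + 2).choose 2)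
    (hconn : IsVertexConnected (d + 1) (chainGraph a)) :
    (IsGenericallyRedundantlyRigid d (chainGraph a) ↔
      (d + 2 ≤ a ⟨1, by omega⟩ ∧ d + 2 ≤ a ⟨k - 2, by omega⟩) ∧
        ¬ ∃ i j : Fin k, (i : ℕ) + 1 = (j : ℕ) ∧ a i = d + 1 ∧ a j = d + 1) ∧
    ((∃ p : Realization (ChainVertex a) d,
        IsGenericRealization p ∧ IsRedundantlyRigid (chainGraph a) p) ↔
      (d + 2 ≤ a ⟨1, by omega⟩ ∧ d + 2 ≤ a ⟨k - 2, by omega⟩) ∧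
        ¬ ∃ i j : Fin k, (i : ℕ) + 1 = (j : ℕ) ∧ a i = d + 1 ∧ a j = d + 1) := by
  have hinner : ∀ i, IsInnerPart i → d + 1 ≤ a i := fun i hi =>
    le_of_isVertexConnected ha hconn hi
  have e : ChainVertex a ≃ Sym2 (Option (Fin d)) := Fintype.equivOfCardEq <| by
    rw [Sym2.card, Fintype.card_sigma]
    simpa using hcard
  -- All generic realizations behave alike, so that the two equivalences are one.
  have key : ∀ p : Realization (ChainVertex a) d, IsGenericRealization p →
      (IsRedundantlyRigid (chainGraph a) p ↔
        (d + 2 ≤ a ⟨1, by omega⟩ ∧ d + 2 ≤ a ⟨k - 2, by omega⟩) ∧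
          ¬ ∃ i j : Fin k, (i : ℕ) + 1 = (j : ℕ) ∧ a i = d + 1 ∧ a j = d + 1) := by
    intro p hp
    have hp' := hp.isQuadricGeneral
    refine ⟨fun hr => ⟨⟨?_, ?_⟩, ?_⟩, fun h => ?_⟩
    · by_contra hlt
      have := hinner ⟨1, by omega⟩ ⟨by simp, by simp only; omega⟩
      refine not_isRedundantlyRigid_of_end_part ha e (i := ⟨0, by omega⟩) (j := ⟨1, by omega⟩)
        (fun l => ?_) (by omega) hp' hr
      simp only [ConsecutiveParts, Fin.ext_iff]
      omega
    · by_contra hlt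
      have := hinner ⟨k - 2, by omega⟩ ⟨by simp only; omega, by simp only; omega⟩
      refine not_isRedundantlyRigid_of_end_part ha e (i := ⟨k - 1, by omega⟩)
        (j := ⟨k - 2, by omega⟩) (fun l => ?_) (by omega) hp' hr
      simp only [ConsecutiveParts, Fin.ext_iff]
      omega
    · rintro ⟨i, j, hij, hi, hj⟩
      obtain ⟨x, y, hxy, h⟩ := exists_not_isLocallyRigid_of_parts_eq e hij hi hj hp'
      exact h (hr _ hxy)
    · obtain ⟨⟨h1, h2⟩, h3⟩ := h
      refine isRedundantlyRigid_chainGraph hk ha hcard hinner (fun i j hij hi => ?_)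
        (fun i j hij => ?_) hp'
      · simp only [IsInnerPart, not_and_or, not_lt] at hi
        have : j = ⟨1, by omega⟩ ∨ j = ⟨k - 2, by omega⟩ := by
          simp only [Fin.ext_iff]
          rcases hij with h | h <;> omega
        rcases this with rfl | rfl
        · exact h1
        · exact h2
      · by_contra! hcon
        obtain ⟨hi, hj, hi', hj'⟩ := hcon
        have hi'' := hinner i hi'
        have hj'' := hinner j hj'
        rcases hij with h | h
        · exact h3 ⟨i, j, h, by omega, by omega⟩
        · exact h3 ⟨j, i, h, by omega, by omega⟩
  obtain ⟨p₀, hp₀⟩ := exists_isGenericRealization (ChainVertex a) d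
  exact ⟨⟨fun h => (key p₀ hp₀).1 (h p₀ hp₀), fun h p hp => (key p hp).2 h⟩,
    ⟨fun ⟨p, hp, hr⟩ => (key p hp).1 hr, fun h => ⟨p₀, hp₀, (key p₀ hp₀).2 h⟩⟩⟩
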